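/- All spaces $C(K)$ are the real Banach spaces of continuous real-valued functions on a compact Hausdorff space $K$ with the maximum norm, and $\delta_k\in C(K)^*$ is evaluation at $k$. A linear isometry into $T\colon X\to Y$ between Banach spaces is a U-embedding if for every $x^*\in X^*$ with $\|x^*\|=1$ there is exactly one $y^*\in Y^*$ with $T^*y^*=x^*$ and $\|y^*\|=\|x^*\|$; $X$ can be U-embedded into $Y$ if a U-embedding $X\to Y$ exists. For a weak-star continuous map $F\colon S\to X^*$ on a compact Hausdorff space $S$, let $T_F\colon X\to C(S)$ be the bounded operator $(T_Fx)(s)=\langle x,F(s)\rangle$. A subset $K\subset S$ is a retract of $S$ if there is a retraction, i.e. a continuous map $r\colon S\to K$ with $r(k)=k$ for all $k\in K$; it is a zero set if $K=\{s\in S: f(s)=0\}$ for some $f\in C(S)$. (1) Let $S$ be a compact Hausdorff space and let $K\subset S$ be a retract of $S$ which is a zero set. Then $C(K)$ can be U-embedded into $C(S)$. More precisely, for every retraction $r\colon S\to K$ and every $f\in C(S)$ with $0\le f\le 1$ and $K=f^{-1}(\{0\})$, the map $$F\colon S\to (C(K)^*,w^*),\qquad F(s)=\frac{1-f(s)}{1+f(s)}\,\delta_{r(s)},$$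 is continuous and $T_F\colon C(K)\to C(S)$ is a U-embedding. (2) If $\alpha<\kappa$ are ordinals, then $C([0,\alpha])$ can be U-embedded into $C([0,\kappa])$ (order topologies). (3) Let $K$ and $S$ be compact Hausdorff spaces and let $h\colon K\to S$ be a neighborhood coretraction, i.e. a topological embedding such that every $t\in K$ has a closed neighborhood $V\subset K$ for which $h(V)$ is a retract of $S$. If $h(K)$ is a zero set in $S$, then $C(K)$ can be U-embedded into $C(S)$. -/

import Mathlib

open Topology

universe u v w

/-- `y` is a Hahn--Banach (norm-preserving) extension of `x` through `T`:
`T^* y = x` and `‖y‖ = ‖x‖`. -/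
def IsHahnBanachExtension {X Y : Type*} [NormedAddCommGroup X] [NormedSpace ℝ X]
    [NormedAddCommGroup Y] [NormedSpace ℝ Y] (T : X →L[ℝ] Y)
    (x : StrongDual ℝ X) (y : StrongDual ℝ Y) : Prop :=
  y.comp T = x ∧ ‖y‖ = ‖x‖

/-- A U-embedding: a linear isometry into, such that every norm-one functional has a unique
Hahn--Banach extension through it. -/
def IsUEmbedding {X Y : Type*} [NormedAddCommGroup X] [NormedSpace ℝ X]
    [NormedAddCommGroup Y] [NormedSpace ℝ Y] (T : X →L[ℝ] Y) : Prop :=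
  Isometry T ∧ ∀ x : StrongDual ℝ X, ‖x‖ = 1 → ∃! y : StrongDual ℝ Y, IsHahnBanachExtension T x y

/-- `X` can be U-embedded into `Y`. -/
def UEmbeds (X Y : Type*) [NormedAddCommGroup X] [NormedSpace ℝ X]
    [NormedAddCommGroup Y] [NormedSpace ℝ Y] : Prop :=
  ∃ T : X →L[ℝ] Y, IsUEmbedding T

/-- `r` is a retraction of `S` onto the subset `K` (surjectivity is automatic). -/
def IsRetraction {S : Type*} [TopologicalSpace S] (K : Set S) (r : C(S, K)) : Prop :=
  ∀ k : K, r k = k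

/-- The subset `K` is a retract of `S`. -/
def IsRetract {S : Type*} [TopologicalSpace S] (K : Set S) : Prop :=
  ∃ r : C(S, K), IsRetraction K r

/-- `K` is a zero set in `S`. -/
def IsZeroSet {S : Type*} [TopologicalSpace S] (K : Set S) : Prop :=
  ∃ f : C(S, ℝ), K = {s | f s = 0}

theorem IsZeroSet.compactSpace {S : Type*} [TopologicalSpace S] [CompactSpace S] {K : Set S}
    (hK : IsZeroSet K) : CompactSpace K := by
  obtain ⟨f, rfl⟩ := hK
  exact isCompact_iff_compactSpace.mp (isClosed_eq f.continuous continuous_const).isCompact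

/-- `h : K → S` is a neighborhood coretraction: a topological embedding such that every point of
`K` has a closed neighborhood `V` for which `h(V)` is a retract of `S`. -/
def IsNeighborhoodCoretraction {K S : Type*} [TopologicalSpace K] [TopologicalSpace S]
    (h : K → S) : Prop :=
  IsEmbedding h ∧ ∀ t : K, ∃ V ∈ 𝓝 t, IsClosed V ∧ IsRetract (h '' V)

/-- The Dirac functional `δ_k`, in the dual of `C(K)` with its weak-star topology. -/
noncomputable def diracFunctional {K : Type*} [TopologicalSpace K] [CompactSpace K] (k : K) :
    WeakDual ℝ C(K, ℝ) :=
  StrongDual.toWeakDual (ContinuousMap.evalCLM ℝ k)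

/-- The operator `T_F : X → C(S)`, `(T_F x)(s) = ⟨x, F(s)⟩`, associated with a weak-star
continuous map `F : S → X^*`. -/
noncomputable def operatorOf {X S : Type*} [NormedAddCommGroup X] [NormedSpace ℝ X]
    [CompleteSpace X] [TopologicalSpace S] [CompactSpace S] (F : C(S, WeakDual ℝ X)) :
    X →L[ℝ] C(S, ℝ) :=
  let L : X →ₗ[ℝ] C(S, ℝ) :=
    { toFun := fun x => ⟨fun s => F s x, (WeakDual.eval_continuous x).comp F.continuous⟩
      map_add' := fun x y => by ext s; exact map_add (F s) x y
      map_smul' := fun c x => by ext s; exact map_smul (F s) c x }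
  { L with
    cont := by
      obtain ⟨C, hC⟩ := banach_steinhaus (g := fun s => WeakDual.toStrongDual (F s))
        (fun x => ⟨‖L x‖, fun s => (L x).norm_coe_le_norm s⟩)
      refine (L.mkContinuous (max C 0) fun x => ?_).continuous
      refine (ContinuousMap.norm_le _ (by positivity)).mpr fun s => ?_
      exact (WeakDual.toStrongDual (F s)).le_of_opNorm_le ((hC s).trans (le_max_left _ _)) x }

theorem operatorOf_apply {X S : Type*} [NormedAddCommGroup X] [NormedSpace ℝ X]
    [CompleteSpace X] [TopologicalSpace S] [CompactSpace S] (F : C(S, WeakDual ℝ X))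
    (x : X) (s : S) : operatorOf F x s = F s x := rfl

/-! Let `T` extend functions along `e : K → S`, with `|T x| ≤ g ‖x‖`, `0 ≤ g ≤ 1`, and `g = 1` only
on the range of `e`. Restriction `R` along `e` is a left inverse of `T`, so `x ∘ R` is a Hahn–Banach
extension of `x`. For uniqueness, let `y` be any such extension with `‖x‖ = 1`. If `|h| ≤ 1 - g`,
both `T z ± ‖z‖ h` have norm at most `‖z‖`, so `|x z| + ‖z‖ |y h| ≤ ‖z‖`, which forces `y h = 0`. By
density `y` kills every function vanishing on the range of `e`, in particular `h - T (R h)`; hence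
`y = x ∘ R` (`isUEmbedding_of_abs_apply_le`). All three parts take for `T` a weighted sum of
compositions with (local) left inverses of `e`. -/

/-- If `|T x| ≤ g ‖x‖` pointwise with `0 ≤ g`, then norm-preserving extensions of norm-one
functionals through `T` vanish on every function dominated by `1 - g`. -/
theorem IsHahnBanachExtension.apply_eq_zero_of_abs_le_one_sub {X S : Type*}
    [NormedAddCommGroup X] [NormedSpace ℝ X] [TopologicalSpace S] [CompactSpace S]
    {T : X →L[ℝ] C(S, ℝ)} {g : C(S, ℝ)} (hT : ∀ x s, |T x s| ≤ g s * ‖x‖) (hg0 : ∀ s, 0 ≤ g s)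
    {x : StrongDual ℝ X} (hx : ‖x‖ = 1) {y : StrongDual ℝ C(S, ℝ)}
    (hy : IsHahnBanachExtension T x y) {h : C(S, ℝ)} (hh : ∀ s, |h s| ≤ 1 - g s) : y h = 0 := by
  have hy1 : ‖y‖ = 1 := hy.2.trans hx
  have bound (k : C(S, ℝ)) (a : ℝ) (ha : 0 ≤ a) (hk : ∀ s, |k s| ≤ a) : |y k| ≤ a := by
    have h1 : ‖k‖ ≤ a := (ContinuousMap.norm_le _ ha).2 hk
    simpa using y.le_of_opNorm_le_of_le hy1.le h1
  have h1 : |y h| ≤ 1 := bound h 1 zero_le_one fun s => (hh s).trans (by linarith [hg0 s])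
  have key (z : X) : ‖x z‖ ≤ (1 - |y h|) * ‖z‖ := by
    have hz : x z = y (T z) := by rw [← hy.1]; rfl
    have hp : |y (T z + ‖z‖ • h)| ≤ ‖z‖ := bound _ _ (norm_nonneg z) fun s => by
      have h2 := mul_le_mul_of_nonneg_left (hh s) (norm_nonneg z)
      have h3 := abs_add_le (T z s) (‖z‖ * h s)
      rw [abs_mul, abs_norm] at h3
      simp only [ContinuousMap.add_apply, ContinuousMap.smul_apply, smul_eq_mul]
      linarith [hT z s]
    have hm : |y (T z - ‖z‖ • h)| ≤ ‖z‖ := bound _ _ (norm_nonneg z) fun s => by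
      have h2 := mul_le_mul_of_nonneg_left (hh s) (norm_nonneg z)
      have h3 := abs_sub (T z s) (‖z‖ * h s)
      rw [abs_mul, abs_norm] at h3
      simp only [ContinuousMap.sub_apply, ContinuousMap.smul_apply, smul_eq_mul]
      linarith [hT z s]
    rw [map_add, map_smul, smul_eq_mul, abs_le] at hp
    rw [map_sub, map_smul, smul_eq_mul, abs_le] at hm
    rw [hz, Real.norm_eq_abs]
    rcases abs_cases (y h) with ⟨e, _⟩ | ⟨e, _⟩ <;> rw [e, abs_le] <;> constructor <;> linarith
  -- This reads `1 = ‖x‖ ≤ 1 - |y h|`.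
  have h2 := x.opNorm_le_bound (by linarith) key
  exact abs_eq_zero.1 (le_antisymm (by linarith) (abs_nonneg _))

/-- A continuous function vanishing wherever `1 ≤ g` is a uniform limit of functions dominated by
multiples of `1 - g`. -/
theorem ContinuousMap.exists_abs_le_mul_one_sub {S : Type*} [TopologicalSpace S] [CompactSpace S]
    {g h : C(S, ℝ)} (hg1 : ∀ s, g s ≤ 1) (hgh : ∀ s, 1 ≤ g s → h s = 0) {ε : ℝ} (hε : 0 < ε) :
    ∃ C : ℝ, 0 < C ∧ ∃ k : C(S, ℝ), (∀ s, |k s| ≤ C * (1 - g s)) ∧ ‖h - k‖ ≤ ε := by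
  -- On the compact set where `|h| ≥ ε`, `g` has a maximum below one.
  obtain ⟨C, hC0, hC⟩ : ∃ C : ℝ, 0 < C ∧ ∀ s, ε ≤ |h s| → 1 ≤ C * (1 - g s) := by
    have hK : IsCompact {s | ε ≤ |h s|} := (isClosed_le (by fun_prop) (by fun_prop)).isCompact
    rcases Set.eq_empty_or_nonempty {s | ε ≤ |h s|} with he | hne
    · exact ⟨1, one_pos, fun s hs => absurd (show s ∈ {s | ε ≤ |h s|} from hs) (by simp [he])⟩
    · obtain ⟨m, hm, hmax⟩ := hK.exists_isMaxOn hne g.continuous.continuousOn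
      have hlt : g m < 1 := by
        by_contra hge
        have h0 : ε ≤ |h m| := hm
        rw [hgh m (not_lt.1 hge), abs_zero] at h0
        linarith
      refine ⟨(1 - g m)⁻¹, inv_pos.2 (by linarith), fun s hs => ?_⟩
      have h1 : g s ≤ g m := hmax hs
      rw [inv_mul_eq_div, le_div_iff₀ (by linarith)]
      linarith
  -- The cutoff `h * min 1 (C * (1 - g))` equals `h` where `|h| ≥ ε` and errs by at most `|h|`
  -- elsewhere. The `+ 1` keeps the constant positive when `h = 0`.
  refine ⟨C * (‖h‖ + 1), by positivity, ⟨fun s => h s * min 1 (C * (1 - g s)), by fun_prop⟩,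
    fun s => ?_, (ContinuousMap.norm_le _ hε.le).2 fun s => ?_⟩
  · have h0 : 0 ≤ C * (1 - g s) := mul_nonneg hC0.le (by linarith [hg1 s])
    have h1 : |h s| ≤ ‖h‖ + 1 := (h.norm_coe_le_norm s).trans (by linarith)
    rw [ContinuousMap.coe_mk, abs_mul, abs_of_nonneg (le_min zero_le_one h0)]
    calc |h s| * min 1 (C * (1 - g s)) ≤ (‖h‖ + 1) * (C * (1 - g s)) :=
          mul_le_mul h1 (min_le_right _ _) (le_min zero_le_one h0) (by positivity)
      _ = C * (‖h‖ + 1) * (1 - g s) := by ring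
  · have h0 : 0 ≤ C * (1 - g s) := mul_nonneg hC0.le (by linarith [hg1 s])
    have e : (h - ⟨fun s => h s * min 1 (C * (1 - g s)), by fun_prop⟩ : C(S, ℝ)) s
        = h s * (1 - min 1 (C * (1 - g s))) := by
      simp only [ContinuousMap.sub_apply, ContinuousMap.coe_mk]; ring
    rw [e]
    rcases le_total ε |h s| with hs | hs
    · rw [min_eq_left (hC s hs)]; simpa using hε.le
    · have h2 : (0 : ℝ) ≤ min 1 (C * (1 - g s)) := le_min zero_le_one h0
      have h3 : min 1 (C * (1 - g s)) ≤ 1 := min_le_left _ _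
      rw [norm_mul, Real.norm_eq_abs, Real.norm_eq_abs, abs_of_nonneg (sub_nonneg.2 h3)]
      exact (mul_le_of_le_one_right (abs_nonneg _) (by linarith)).trans hs

/-- A linear extension operator `T` from the range of `e` which is dominated by a function `g ≤ 1`
that is strictly less than one off the range of `e` is a U-embedding. -/
theorem isUEmbedding_of_abs_apply_le {K S : Type*} [TopologicalSpace K] [CompactSpace K]
    [TopologicalSpace S] [CompactSpace S] (e : C(K, S)) {T : C(K, ℝ) →L[ℝ] C(S, ℝ)} {g : C(S, ℝ)}
    (hg0 : ∀ s, 0 ≤ g s) (hg1 : ∀ s, g s ≤ 1) (hge : ∀ s, 1 ≤ g s → s ∈ Set.range e)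
    (hT : ∀ x s, |T x s| ≤ g s * ‖x‖) (hTe : ∀ x k, T x (e k) = x k) : IsUEmbedding T := by
  have hTle (x : C(K, ℝ)) : ‖T x‖ ≤ ‖x‖ := (ContinuousMap.norm_le _ (norm_nonneg x)).2 fun s =>
    (hT x s).trans (mul_le_of_le_one_left (norm_nonneg x) (hg1 s))
  have hiso : Isometry T := AddMonoidHomClass.isometry_of_norm T fun x =>
    le_antisymm (hTle x) <| (ContinuousMap.norm_le _ (norm_nonneg _)).2 fun k => by
      rw [← hTe x k]; exact (T x).norm_coe_le_norm (e k)
  refine ⟨hiso, fun x hx => ?_⟩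
  let R : C(S, ℝ) →ₗ[ℝ] C(K, ℝ) :=
    { toFun := fun h => h.comp e
      map_add' := fun _ _ => rfl
      map_smul' := fun _ _ => rfl }
  have hR (h : C(S, ℝ)) : ‖R h‖ ≤ ‖h‖ := (ContinuousMap.norm_le _ (norm_nonneg h)).2 fun k =>
    h.norm_coe_le_norm (e k)
  have hRT (z : C(K, ℝ)) : R (T z) = z := ContinuousMap.ext fun k => hTe z k
  let Rc : C(S, ℝ) →L[ℝ] C(K, ℝ) := R.mkContinuous 1 fun h => by simpa using hR h
  have hcomp : (x.comp Rc).comp T = x := ContinuousLinearMap.ext fun z => congrArg x (hRT z)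
  refine ⟨x.comp Rc, ⟨hcomp, le_antisymm ?_ ?_⟩, fun y hy => ?_⟩
  · exact ContinuousLinearMap.opNorm_le_bound _ (norm_nonneg x) fun h =>
      x.le_opNorm_of_le (hR h)
  · refine ContinuousLinearMap.opNorm_le_bound _ (norm_nonneg _) fun z => ?_
    have h1 := (x.comp Rc).le_opNorm_of_le (hTle z)
    rwa [← ContinuousLinearMap.comp_apply, hcomp] at h1
  · have hvanish (h : C(S, ℝ)) (hh : ∀ k, h (e k) = 0) : y h = 0 := by
      refine abs_eq_zero.1 (le_antisymm (le_of_forall_pos_le_add fun ε hε => ?_) (abs_nonneg _))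
      obtain ⟨C, hC, k, hk, hhk⟩ := ContinuousMap.exists_abs_le_mul_one_sub (h := h) hg1
        (fun s hs => by obtain ⟨k, rfl⟩ := hge s hs; exact hh k) hε
      have h1 : y (C⁻¹ • k) = 0 := hy.apply_eq_zero_of_abs_le_one_sub hT hg0 hx fun s => by
        rw [ContinuousMap.smul_apply, smul_eq_mul, abs_mul, abs_of_pos (inv_pos.2 hC),
          inv_mul_le_iff₀ hC]
        exact hk s
      rw [map_smul, smul_eq_zero_iff_right (inv_ne_zero hC.ne')] at h1
      have h2 := y.le_of_opNorm_le_of_le (hy.2.trans hx).le hhk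
      rwa [map_sub, h1, sub_zero, one_mul, Real.norm_eq_abs, ← zero_add ε] at h2
    ext h
    have h1 := hvanish (h - T (R h)) fun k => by
      rw [ContinuousMap.sub_apply, hTe]; exact sub_self _
    rw [map_sub, sub_eq_zero] at h1
    rw [h1, ← ContinuousLinearMap.comp_apply, hy.1]
    rfl

/-- The weak-star continuous map `s ↦ ∑ i, ψ i s • δ_{r i s}`. -/
noncomputable def sumSMulDirac {K S ι : Type*} [TopologicalSpace K] [CompactSpace K]
    [TopologicalSpace S] [Fintype ι] (ψ : ι → C(S, ℝ)) (r : ι → C(S, K)) :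
    C(S, WeakDual ℝ C(K, ℝ)) where
  toFun s := ∑ i, ψ i s • diracFunctional (r i s)
  continuous_toFun := continuous_finsetSum _ fun i _ => (ψ i).continuous.smul <|
    WeakDual.continuous_of_continuous_eval fun x => x.continuous.comp (r i).continuous

theorem operatorOf_sumSMulDirac_apply {K S ι : Type*} [TopologicalSpace K] [CompactSpace K]
    [TopologicalSpace S] [CompactSpace S] [Fintype ι] (ψ : ι → C(S, ℝ)) (r : ι → C(S, K))
    (x : C(K, ℝ)) (s : S) : operatorOf (sumSMulDirac ψ r) x s = ∑ i, ψ i s * x (r i s) := by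
  have h := sum_apply Finset.univ
    (fun i => WeakDual.toStrongDual (ψ i s • diracFunctional (r i s))) x
  rw [operatorOf_apply]
  refine Eq.trans ?_ h
  change (∑ i, ψ i s • diracFunctional (r i s) : WeakDual ℝ C(K, ℝ)) x = _
  rw [← map_sum]
  rfl

/-- A partition of unity along `e`, extended to `S` and glued from local left inverses of `e`,
gives a U-embedding. -/
theorem isUEmbedding_operatorOf_sumSMulDirac {K S ι : Type*} [TopologicalSpace K] [CompactSpace K]
    [TopologicalSpace S] [CompactSpace S] [Fintype ι] (e : C(K, S)) (ψ : ι → C(S, ℝ))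
    (r : ι → C(S, K)) (hψ0 : ∀ i s, 0 ≤ ψ i s) (hψ1 : ∀ s, ∑ i, ψ i s ≤ 1)
    (hψe : ∀ s, 1 ≤ ∑ i, ψ i s → s ∈ Set.range e) (heψ : ∀ k, ∑ i, ψ i (e k) = 1)
    (hr : ∀ i k, ψ i (e k) ≠ 0 → r i (e k) = k) :
    IsUEmbedding (operatorOf (sumSMulDirac ψ r)) := by
  refine isUEmbedding_of_abs_apply_le e (g := ∑ i, ψ i) ?_ ?_ ?_ ?_ ?_
  · intro s
    simpa using Finset.sum_nonneg fun i _ => hψ0 i s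
  · simpa using hψ1
  · simpa using hψe
  · intro x s
    rw [operatorOf_sumSMulDirac_apply, ContinuousMap.sum_apply, Finset.sum_mul]
    refine (Finset.abs_sum_le_sum_abs _ _).trans (Finset.sum_le_sum fun i _ => ?_)
    rw [abs_mul, abs_of_nonneg (hψ0 i s)]
    exact mul_le_mul_of_nonneg_left (x.norm_coe_le_norm _) (hψ0 i s)
  · intro x k
    rw [operatorOf_sumSMulDirac_apply]
    calc ∑ i, ψ i (e k) * x (r i (e k)) = ∑ i, ψ i (e k) * x k :=
          Finset.sum_congr rfl fun i _ => by
            rcases eq_or_ne (ψ i (e k)) 0 with h | h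
            · rw [h, zero_mul, zero_mul]
            · rw [hr i k h]
      _ = x k := by rw [← Finset.sum_mul, heψ, one_mul]

/-- Weighted composition with a left inverse of `e`, the weight being one exactly on the range of
`e`, is a U-embedding. -/
theorem isUEmbedding_operatorOf_smulDirac {K S : Type*} [TopologicalSpace K] [CompactSpace K]
    [TopologicalSpace S] [CompactSpace S] (e : C(K, S)) (g : C(S, ℝ)) (r : C(S, K))
    (hg0 : ∀ s, 0 ≤ g s) (hg1 : ∀ s, g s ≤ 1) (hge : ∀ s, 1 ≤ g s → s ∈ Set.range e)
    (heg : ∀ k, g (e k) = 1) (hr : ∀ k, r (e k) = k) :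
    IsUEmbedding (operatorOf (sumSMulDirac (fun _ : Unit => g) fun _ => r)) :=
  isUEmbedding_operatorOf_sumSMulDirac e _ _ (fun _ => hg0) (by simpa using hg1)
    (by simpa using hge) (by simpa using heg) fun _ k _ => hr k

/-- The weight `(1 - f) / (1 + f)` lies in `[0, 1]` and equals one exactly where `f = 0`. -/
theorem IsRetraction.exists_isUEmbedding_operatorOf {S : Type*} [TopologicalSpace S]
    [CompactSpace S] {K : Set S} [CompactSpace K] {r : C(S, K)} (hr : IsRetraction K r)
    {f : C(S, ℝ)} (hK : K = {s | f s = 0}) (hf : ∀ s, 0 ≤ f s ∧ f s ≤ 1) :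
    ∃ F : C(S, WeakDual ℝ C(K, ℝ)),
      (∀ s, F s = ((1 - f s) / (1 + f s)) • diracFunctional (r s)) ∧
      IsUEmbedding (operatorOf F) := by
  have hpos (s : S) : 0 < 1 + f s := by linarith [(hf s).1]
  let g : C(S, ℝ) := ⟨fun s => (1 - f s) / (1 + f s),
    Continuous.div (by fun_prop) (by fun_prop) fun s => (hpos s).ne'⟩
  have hK' (s : S) : s ∈ K ↔ f s = 0 := by
    conv_lhs => rw [hK]
    rfl
  refine ⟨sumSMulDirac (fun _ : Unit => g) fun _ => r, fun s => by simp [sumSMulDirac, g], ?_⟩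
  refine isUEmbedding_operatorOf_smulDirac ⟨Subtype.val, continuous_subtype_val⟩ g r
    (fun s => div_nonneg (by linarith [(hf s).2]) (hpos s).le)
    (fun s => (div_le_one (hpos s)).2 (by linarith [(hf s).1])) (fun s hs => ?_)
    (fun k => ?_) hr
  · have h1 := (one_le_div (hpos s)).1 hs
    exact ⟨⟨s, (hK' s).2 (by linarith [(hf s).1])⟩, rfl⟩
  · simp [g, (hK' k).1 k.2]

theorem IsRetract.uEmbeds {S : Type*} [TopologicalSpace S] [CompactSpace S] {K : Set S}
    [CompactSpace K] (h : IsRetract K) (hK : IsZeroSet K) : UEmbeds C(K, ℝ) C(S, ℝ) := by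
  obtain ⟨r, hr⟩ := h
  obtain ⟨f, hf⟩ := hK
  have hmin (s : S) : f s = 0 ↔ min |f s| 1 = 0 := by
    refine ⟨fun h => by simp [h], fun h => ?_⟩
    rcases min_choice |f s| 1 with h1 | h1
    · exact abs_eq_zero.1 (h1.symm.trans h)
    · exact absurd (h1.symm.trans h) one_ne_zero
  obtain ⟨F, -, hF⟩ := hr.exists_isUEmbedding_operatorOf (f := ⟨fun s => min |f s| 1, by fun_prop⟩)
    (hf.trans (Set.ext hmin)) fun s => ⟨le_min (abs_nonneg _) zero_le_one, min_le_right _ _⟩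
  exact ⟨_, hF⟩

/-- The initial segment up to `α` is clopen, being also `{s < α + 1}`, and `min · α` retracts onto
it; its indicator serves as weight. -/
theorem Ordinal.uEmbeds_continuousMap_Icc {α κ : Ordinal} (h : α < κ) :
    UEmbeds C(Set.Icc 0 α, ℝ) C(Set.Icc 0 κ, ℝ) := by
  let e : C(Set.Icc 0 α, Set.Icc 0 κ) := ⟨fun k => ⟨k, k.2.1, k.2.2.trans h.le⟩, by fun_prop⟩
  let r : C(Set.Icc 0 κ, Set.Icc 0 α) := ⟨fun s => ⟨min s α, bot_le, min_le_right _ _⟩,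
    (continuous_subtype_val.min continuous_const).subtype_mk _⟩
  have hclopen : IsClopen {s : Set.Icc 0 κ | (s : Ordinal) ≤ α} :=
    ⟨isClosed_le continuous_subtype_val continuous_const, by
      simpa only [Order.lt_succ_iff] using
        isOpen_lt (continuous_subtype_val (p := (· ∈ Set.Icc 0 κ)))
          (continuous_const (y := Order.succ α))⟩
  let g : C(Set.Icc 0 κ, ℝ) := ⟨Set.indicator {s | (s : Ordinal) ≤ α} 1,
    continuous_one.indicator fun a ha => by simp [hclopen.frontier_eq] at ha⟩
  refine ⟨_, isUEmbedding_operatorOf_smulDirac e g r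
    (fun s => Set.indicator_nonneg (fun _ _ => zero_le_one) s)
    (fun s => Set.indicator_le_self' (fun _ _ => zero_le_one) s) (fun s hs => ?_)
    (fun k => Set.indicator_of_mem (s := {s : Set.Icc 0 κ | (s : Ordinal) ≤ α}) k.2.2 _)
    fun k => Subtype.ext (min_eq_left k.2.2)⟩
  by_contra hne
  have hs' : s ∉ {s : Set.Icc 0 κ | (s : Ordinal) ≤ α} := fun h => hne ⟨⟨s, s.2.1, h⟩, rfl⟩
  have h0 : g s = 0 := Set.indicator_of_notMem hs' _
  linarith

theorem Topology.IsEmbedding.exists_leftInverse_of_isRetract {K S : Type*} [TopologicalSpace K]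
    [TopologicalSpace S] {h : K → S} (hh : IsEmbedding h) {V : Set K} (hV : IsRetract (h '' V)) :
    ∃ r : C(S, K), ∀ t ∈ V, r (h t) = t := by
  obtain ⟨r, hr⟩ := hV
  refine ⟨⟨fun s => hh.toHomeomorph.symm ⟨r s, Set.image_subset_range _ _ (r s).2⟩, by fun_prop⟩,
    fun t ht => ?_⟩
  refine hh.toHomeomorph.symm_apply_eq.2 (Subtype.ext ?_)
  change (r (h t) : S) = h t
  exact congrArg Subtype.val (hr ⟨h t, t, ht, rfl⟩)

theorem IsNeighborhoodCoretraction.uEmbeds {K S : Type*} [TopologicalSpace K] [CompactSpace K]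
    [T2Space K] [TopologicalSpace S] [CompactSpace S] [T2Space S] {h : K → S}
    (hh : IsNeighborhoodCoretraction h) (hz : IsZeroSet (Set.range h)) :
    UEmbeds C(K, ℝ) C(S, ℝ) := by
  obtain ⟨hemb, hloc⟩ := hh
  obtain ⟨f, hf⟩ := hz
  have hf' (s : S) : s ∈ Set.range h ↔ f s = 0 := by rw [hf]; rfl
  have hcl : IsClosedEmbedding h := hemb.continuous.isClosedEmbedding hemb.injective
  choose V hV _ hret using hloc
  choose r hr using fun t => hemb.exists_leftInverse_of_isRetract (hret t)
  obtain ⟨A, -, hA⟩ := isCompact_univ.elim_nhds_subcover (fun t => interior (V t)) fun t _ =>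
    interior_mem_nhds.2 (hV t)
  obtain ⟨φ, hφ⟩ := PartitionOfUnity.exists_isSubordinate isClosed_univ
    (fun i : A => interior (V i)) (fun _ => isOpen_interior)
    fun t ht => by simpa using hA ht
  -- Tietze extension may lose the sign and the sum bound; `D` below restores both properties for
  -- `|ψ i|`.
  choose ψ hψ using fun i : A => (φ i).exists_extension' hcl
  have hψφ (i : A) (k : K) : ψ i (h k) = φ i k := congrFun (hψ i) k
  have hφ1 (k : K) : ∑ i, φ i k = 1 := by
    rw [← finsum_eq_sum_of_fintype]; exact φ.sum_eq_one (Set.mem_univ k)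
  -- The factor `max _ 1` brings the sum of the weights down to at most one, and `1 + |f|` makes it
  -- strictly less off the range of `h`. On the range `D = 1`, so the partition of unity is
  -- unchanged.
  let D : C(S, ℝ) := ⟨fun s => max (∑ i, |ψ i s|) 1 * (1 + |f s|), by fun_prop⟩
  have hD (s : S) : 0 < D s := mul_pos (by positivity) (by positivity)
  let χ (i : A) : C(S, ℝ) := ⟨fun s => |ψ i s| / D s,
    Continuous.div (by fun_prop) D.continuous fun s => (hD s).ne'⟩
  have hsum (s : S) : ∑ i, χ i s = (∑ i, |ψ i s|) / D s := (Finset.sum_div _ _ _).symm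
  have hsumD (s : S) : (∑ i, |ψ i s|) * (1 + |f s|) ≤ D s :=
    mul_le_mul_of_nonneg_right (le_max_left _ _) (by positivity)
  have hsum0 (s : S) : 0 ≤ ∑ i, |ψ i s| := Finset.sum_nonneg fun _ _ => abs_nonneg _
  have habs (k : K) : ∑ i, |ψ i (h k)| = 1 := by
    simp_rw [hψφ, abs_of_nonneg (φ.nonneg _ k), hφ1]
  have hDh (k : K) : D (h k) = 1 := by
    change max (∑ i, |ψ i (h k)|) 1 * (1 + |f (h k)|) = 1
    rw [habs, (hf' (h k)).1 ⟨k, rfl⟩]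
    simp
  refine ⟨_, isUEmbedding_operatorOf_sumSMulDirac ⟨h, hemb.continuous⟩ χ (fun i => r i)
    (fun i s => div_nonneg (abs_nonneg _) (hD s).le) (fun s => ?_) (fun s hs => ?_) (fun k => ?_)
    fun i k hk => ?_⟩
  · rw [hsum, div_le_one (hD s)]
    exact (le_mul_of_one_le_right (hsum0 s) (by simp)).trans (hsumD s)
  · rw [hsum, one_le_div (hD s)] at hs
    refine (hf' s).2 (abs_eq_zero.1 (le_antisymm ?_ (abs_nonneg _)))
    have h1 : 1 * (1 + |f s|) ≤ D s := mul_le_mul_of_nonneg_right (le_max_right _ _) (by positivity)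
    have h2 := hsumD s
    by_contra! hlt
    -- `D ≤ ∑ |ψ i|` and `hsumD` give `(∑ |ψ i|) |f| ≤ 0`, while `∑ |ψ i| ≥ 1 + |f| > 0`.
    nlinarith
  · rw [ContinuousMap.coe_mk, hsum, habs, hDh, div_one]
  -- Subordination: a nonzero weight at `h k` puts `k` in `V i`, where `r i` inverts `h`.
  · refine hr i k (interior_subset (hφ i (subset_tsupport _ fun h0 => hk ?_)))
    simp [χ, hψφ, h0]

theorem mainTheorem9 :
    -- a retract which is a zero set
    (∀ (S : Type u) [TopologicalSpace S] [CompactSpace S] [T2Space S] (K : Set S)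
      (hK : IsZeroSet K), IsRetract K →
        haveI : CompactSpace K := hK.compactSpace
        UEmbeds C(K, ℝ) C(S, ℝ) ∧
        -- every retraction and every defining function produce an explicit U-embedding
        ∀ (r : C(S, K)) (f : C(S, ℝ)), IsRetraction K r → K = {s | f s = 0} →
          (∀ s, 0 ≤ f s ∧ f s ≤ 1) →
          ∃ F : C(S, WeakDual ℝ C(K, ℝ)),
            (∀ s, F s = ((1 - f s) / (1 + f s)) • diracFunctional (r s)) ∧
            IsUEmbedding (operatorOf F)) ∧
    -- ordinal intervals
    (∀ α κ : Ordinal.{w}, α < κ →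
      UEmbeds C(Set.Icc (0 : Ordinal.{w}) α, ℝ) C(Set.Icc (0 : Ordinal.{w}) κ, ℝ)) ∧
    -- neighborhood coretractions whose image is a zero set
    (∀ (K : Type v) (S : Type u) [TopologicalSpace K] [CompactSpace K] [T2Space K]
      [TopologicalSpace S] [CompactSpace S] [T2Space S] (h : K → S),
        IsNeighborhoodCoretraction h → IsZeroSet (Set.range h) →
        UEmbeds C(K, ℝ) C(S, ℝ)) := by
  exact ⟨fun S _ _ _ K hK hret =>
    haveI : CompactSpace K := hK.compactSpace
    ⟨hret.uEmbeds hK, fun _ _ hr hf h01 => hr.exists_isUEmbedding_operatorOf hf h01⟩,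
    fun _ _ h => Ordinal.uEmbeds_continuousMap_Icc h,
    fun _ _ _ _ _ _ _ _ _ hh hz => hh.uEmbeds hz⟩
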